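/- All graphs are finite. An oriented graph is a directed graph in which any two distinct vertices are joined by at most one arc; loops are allowed. A reflexive tournament is a directed graph with a loop at every vertex in which any two distinct vertices are joined by exactly one arc. For a vertex $v$, $N^+(v)$ (resp. $N^-(v)$) is the set of vertices $u$ such that $vu$ (resp. $uv$) is an arc, so a vertex with a loop belongs to both of its neighbourhoods; the out-degree (resp. in-degree) of $v$ is $|N^+(v)|$ (resp. $|N^-(v)|$), and its strict out-neighbourhood (resp. strict in-neighbourhood) is $N^+(v)\setminus\{v\}$ (resp. $N^-(v)\setminus\{v\}$). An iot-injective homomorphism from $G$ to $H$ is a map $f:V(G)\to V(H)$ that preserves arcs and whose restriction to $N^+(u)\cup N^-(u)$ is injective for every $u\in V(G)$. For a fixed $H$, the decision problem *iot-injective homomorphism to $H$* has as its instances the finite oriented graphs $G$ (given by the number of vertices and a list of the arcs) and asks whether $G$ has an iot-injective homomorphism to $H$. A problem $P$ polynomially transforms to a problem $Q$ if some map from instances to instances, computable by a Turing machine in polynomial time, sends $G$ to a yes-instance of $Q$ if and only if $G$ is a yes-instance of $P$. Let $T$ be a reflexive tournament and let $v$ be a vertex of $T$. 1. If $v$ has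 out-degree at least four, then iot-injective homomorphism to $T'$ polynomially transforms to iot-injective homomorphism to $T$, where $T'$ is the reflexive tournament induced by the strict out-neighbourhood of $v$. 2. If $v$ has in-degree at least four, then iot-injective homomorphism to $T'$ polynomially transforms to iot-injective homomorphism to $T$, where $T'$ is the reflexive tournament induced by the strict in-neighbourhood of $v$. In both cases the transformation can be chosen so that it maps oriented graphs without loops to oriented graphs without loops. -/

import Mathlib

namespace IotHom

section Digraphs

variable {V W : Type*}

/-- `N⁺(v)`: all `u` such that `vu` is an arc (so `v ∈ N⁺(v)` if there is a loop at `v`). -/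
def outNbhd (D : Digraph V) (v : V) : Set V := {u | D.Adj v u}

/-- `N⁻(v)`: all `u` such that `uv` is an arc (so `v ∈ N⁻(v)` if there is a loop at `v`). -/
def inNbhd (D : Digraph V) (v : V) : Set V := {u | D.Adj u v}

/-- The strict out-neighbourhood of `v`: the out-neighbours other than `v` itself. -/
def strictOutNbhd (D : Digraph V) (v : V) : Set V := outNbhd D v \ {v}

/-- The strict in-neighbourhood of `v`: the in-neighbours other than `v` itself. -/
def strictInNbhd (D : Digraph V) (v : V) : Set V := inNbhd D v \ {v}

/-- The out-degree of `v`; a loop at `v` contributes one. -/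
noncomputable def outDegree (D : Digraph V) (v : V) : ℕ := (outNbhd D v).ncard

/-- The in-degree of `v`; a loop at `v` contributes one. -/
noncomputable def inDegree (D : Digraph V) (v : V) : ℕ := (inNbhd D v).ncard

/-- The subdigraph induced by a set of vertices. -/
def induced (D : Digraph V) (s : Set V) : Digraph s := ⟨fun a b => D.Adj a b⟩

/-- A digraph is oriented if any two distinct vertices are joined by at most one arc
(loops are allowed). -/
def IsOriented (D : Digraph V) : Prop := ∀ u w, u ≠ w → D.Adj u w → ¬ D.Adj w u

/-- A digraph is irreflexive if it has no loops. -/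
def IsIrreflexive (D : Digraph V) : Prop := ∀ u, ¬ D.Adj u u

/-- A reflexive tournament: there is a loop at every vertex, and any two distinct vertices are
joined by exactly one arc. -/
structure IsReflexiveTournament (T : Digraph V) : Prop where
  refl : ∀ u, T.Adj u u
  total : ∀ u w, u ≠ w → T.Adj u w ∨ T.Adj w u
  oriented : IsOriented T

/-- An iot-injective ("in and out together") homomorphism from `D` to `T`: it preserves arcs and
is injective on `N⁺(u) ∪ N⁻(u)` for every vertex `u` of `D`. -/
structure IsIotInjectiveHom (D : Digraph V) (T : Digraph W) (f : V → W) : Prop where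
  map_adj : ∀ u w, D.Adj u w → T.Adj (f u) (f w)
  injOn : ∀ u, Set.InjOn f (outNbhd D u ∪ inNbhd D u)

end Digraphs

/-- A finite oriented graph given as a problem instance: the number of vertices, the vertices
being `0, …, order - 1`, and a list without repetitions of its arcs. -/
structure Instance where
  order : ℕ
  arcs : List (ℕ × ℕ)
  arcs_lt : ∀ a ∈ arcs, a.1 < order ∧ a.2 < order
  nodup : arcs.Nodup
  oriented : ∀ i j, i ≠ j → (i, j) ∈ arcs → (j, i) ∉ arcs

namespace Instance

/-- The oriented graph that an instance describes. -/
def graph (G : Instance) : Digraph (Fin G.order) := ⟨fun i j => ((i : ℕ), (j : ℕ)) ∈ G.arcs⟩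

theorem graph_isOriented (G : Instance) : IsOriented G.graph := fun i j hij h =>
  G.oriented i j (fun e => hij (Fin.ext e)) h

/-- Every oriented graph on finitely many vertices is described by some instance. -/
theorem exists_graph_eq {n : ℕ} (D : Digraph (Fin n)) (hD : IsOriented D) :
    ∃ (G : Instance) (h : G.order = n), ∀ i j : Fin G.order,
      G.graph.Adj i j ↔ D.Adj (Fin.cast h i) (Fin.cast h j) := by
  classical
  let S : Finset (ℕ × ℕ) :=
    (Finset.univ.filter fun p : Fin n × Fin n => D.Adj p.1 p.2).image
      fun p => ((p.1 : ℕ), (p.2 : ℕ))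
  have hS : ∀ a b : ℕ, (a, b) ∈ S.toList ↔ ∃ i j : Fin n, D.Adj i j ∧ (i : ℕ) = a ∧ (j : ℕ) = b := by
    intro a b
    simp [S]
  refine ⟨⟨n, S.toList, ?_, S.nodup_toList, ?_⟩, rfl, ?_⟩
  · rintro ⟨a, b⟩ h
    obtain ⟨i, j, -, rfl, rfl⟩ := (hS a b).1 h
    exact ⟨i.2, j.2⟩
  · intro a b hab h h'
    obtain ⟨i, j, hij, rfl, rfl⟩ := (hS a b).1 h
    obtain ⟨j', i', hji, hj, hi⟩ := (hS _ _).1 h'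
    obtain rfl := Fin.ext hj
    obtain rfl := Fin.ext hi
    exact hD _ _ (fun e => hab (congrArg _ e)) hij hji
  · intro i j
    refine (hS i j).trans ⟨?_, fun h => ⟨_, _, h, rfl, rfl⟩⟩
    rintro ⟨i', j', h, hi, hj⟩
    obtain rfl : i' = i := Fin.ext hi
    obtain rfl : j' = j := Fin.ext hj
    exact h

/-- The code of a natural number: `n` ones followed by a zero. -/
def encodeNat (n : ℕ) : List Bool := List.replicate n true ++ [false]

/-- The code of an arc: the codes of its tail and of its head. -/
def encodeArc (a : ℕ × ℕ) : List Bool := encodeNat a.1 ++ encodeNat a.2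

/-- The binary word that encodes an instance: the number of vertices, then the list of arcs.
Its length is polynomially related to that of the adjacency matrix. -/
def encode (G : Instance) : List Bool := encodeNat G.order ++ G.arcs.flatMap encodeArc

theorem encodeNat_append_inj {m n : ℕ} {u w : List Bool}
    (h : encodeNat m ++ u = encodeNat n ++ w) : m = n ∧ u = w := by
  induction m generalizing n with
  | zero => cases n <;> simp_all [encodeNat, List.replicate_succ]
  | succ m ih =>
    cases n with
    | zero => simp [encodeNat, List.replicate_succ] at h
    | succ n =>
      have := @ih n (by simpa [encodeNat, List.replicate_succ] using h)
      exact ⟨by rw [this.1], this.2⟩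

theorem encodeArcs_injective : ∀ {k l : List (ℕ × ℕ)},
    k.flatMap encodeArc = l.flatMap encodeArc → k = l
  | [], [], _ => rfl
  | [], b :: l, h => by simp [encodeArc, encodeNat] at h
  | a :: k, [], h => by simp [encodeArc, encodeNat] at h
  | a :: k, b :: l, h => by
    simp only [List.flatMap_cons, encodeArc, List.append_assoc] at h
    obtain ⟨h1, h⟩ := encodeNat_append_inj h
    obtain ⟨h2, h⟩ := encodeNat_append_inj h
    rw [Prod.ext h1 h2, encodeArcs_injective h]

/-- Distinct instances have distinct codes. -/
theorem encode_injective : Function.Injective encode := by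
  rintro ⟨n, k, _, _, _⟩ ⟨m, l, _, _, _⟩ h
  obtain ⟨h1, h⟩ := encodeNat_append_inj h
  obtain rfl : n = m := h1
  obtain rfl : k = l := encodeArcs_injective h
  rfl

end Instance

/-- The decision problem "iot-injective homomorphism to `T`": the set of its yes-instances. -/
def IotInjectiveHomTo {W : Type*} (T : Digraph W) : Set Instance :=
  {G | ∃ f : Fin G.order → W, IsIotInjectiveHom G.graph T f}

/-- `f` is a polynomial transformation from the decision problem `P` to the decision problem `Q`:
a Turing machine computes `f` in polynomial time, and `f` maps yes-instances, and only
yes-instances, of `P` to yes-instances of `Q`. -/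
structure IsPolynomialTransformation (P Q : Set Instance) (f : Instance → Instance) : Prop where
  computable : Nonempty (Turing.TM2ComputableInPolyTime Instance.encode Instance.encode f)
  correct : ∀ G, G ∈ P ↔ f G ∈ Q

end IotHom

/-! The transformation keeps the given graph, on vertices `y i`, and attaches a rigid frame that
offers each `y i` its own vertex forced to act as `v`. The frame starts with a loopless copy `w 0 u`
of `T`. Any two of its vertices have a common neighbour, so a homomorphism restricts there to an
automorphism α of `T` (`injective_layer_zero`, `adj_of_adj_layer_zero`). Further layers `z k u` and
`w (k + 1) u` are linked so that injectivity carries α along: `w j u` and `z (2 * i) u` must go to α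
u (`apply_w`, `apply_z`).

In an even layer, `z (2 * i) v` is linked only to `w (2 * i) v` and to `y i`, by an arc directed
according to `out`. Hence `y i` goes to a strict out- or in-neighbour of α v, and composing with α⁻¹
gives a homomorphism to the neighbourhood. Conversely, sending `w j u` and `z j u` to `u` extends
any such homomorphism. The odd layers omit no link and make up for those omitted at `v`. The degree
bound serves to give `T` four vertices, so that some vertex avoids any three.

Since `T` is fixed, numbering the frame layer by layer makes the arcs added for `y i` a translate of
one fixed list. A four-stack machine working on unary numbers writes such a list in polynomial time.
-/

namespace IotHom

/-! ### A stack machine for affine rewriting of unary codes -/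

namespace Transducer

/-- The stacks of the machine; `inp` serves both as input and as output stack. -/
inductive Stack
  | inp | cnt | aux | rev
  deriving DecidableEq

instance : Fintype Stack := ⟨{.inp, .cnt, .aux, .rev}, by rintro ⟨⟩ <;> simp⟩

/-- The labels of the machine, for a list of `l` offsets. -/
inductive Label (l : ℕ)
  | order | arcs | loop | up (j : Fin l) | down (j : Fin l) | flush
  deriving DecidableEq, Fintype

open Turing.TM2 Turing.TM2.Stmt Stack Label

/-- A statement of the machine. -/
abbrev Code (l : ℕ) := Stmt (fun _ : Stack => Bool) (Label l) (Option Bool)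

/-- Push the letters of `w` one after the other on stack `k`. -/
def pushWord {l : ℕ} (k : Stack) : List Bool → Code l → Code l
  | [], q => q
  | b :: w, q => push k (fun _ => b) (pushWord k w q)

/-- Pop stack `k` and continue with one of three statements, according to the letter found. -/
def popCases {l : ℕ} (k : Stack) (t f n : Code l) : Code l :=
  pop k (fun _ o => o) (branch (fun s => s == some true) t (branch (fun s => s == some false) f n))

/-- The label at which the output of the `j`-th offset begins. -/
def enter (l j : ℕ) : Label l := if h : j < l then up ⟨j, h⟩ else loop

/-- The program. It multiplies all numbers in the input by `M`, adding `c` to the first one, and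
then writes the blocks of numbers `M * i + d`, for `d` in `D`, for all `i` below the first number,
and finally the word `E`. -/
def program (M c : ℕ) (D : List ℕ) (E : List Bool) : Label D.length → Code D.length
  | order => popCases inp
      (pushWord rev (List.replicate M true) (pushWord cnt [true] (goto fun _ => order)))
      (pushWord rev (Instance.encodeNat c) (goto fun _ => arcs)) halt
  | arcs => popCases inp
      (pushWord rev (List.replicate M true) (goto fun _ => arcs))
      (pushWord rev [false] (goto fun _ => arcs)) (goto fun _ => loop)
  | loop => popCases cnt (goto fun _ => enter D.length 0) halt
      (pushWord rev E (goto fun _ => flush))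
  | up j => popCases cnt
      (pushWord aux [true] (pushWord rev (List.replicate M true) (goto fun _ => up j))) halt
      (pushWord rev (Instance.encodeNat D[j]) (goto fun _ => down j))
  | down j => popCases aux (pushWord cnt [true] (goto fun _ => down j)) halt
      (goto fun _ => enter D.length (j + 1))
  | flush => popCases rev (pushWord inp [true] (goto fun _ => flush))
      (pushWord inp [false] (goto fun _ => flush)) halt

/-- The contents of the four stacks. -/
def contents (a b c d : List Bool) : Stack → List Bool
  | inp => a
  | cnt => b
  | aux => c
  | rev => d

section
variable (a b c d x : List Bool)

@[simp] lemma update_inp : Function.update (contents a b c d) inp x = contents x b c d := by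
  funext k; cases k <;> rfl

@[simp] lemma update_cnt : Function.update (contents a b c d) cnt x = contents a x c d := by
  funext k; cases k <;> rfl

@[simp] lemma update_aux : Function.update (contents a b c d) aux x = contents a b x d := by
  funext k; cases k <;> rfl

@[simp] lemma update_rev : Function.update (contents a b c d) rev x = contents a b c x := by
  funext k; cases k <;> rfl

@[simp] lemma contents_inp : contents a b c d inp = a := rfl
@[simp] lemma contents_cnt : contents a b c d cnt = b := rfl
@[simp] lemma contents_aux : contents a b c d aux = c := rfl
@[simp] lemma contents_rev : contents a b c d rev = d := rfl

end

@[simp] lemma stepAux_pushWord {l : ℕ} (k : Stack) (w : List Bool) (q : Code l) (s : Option Bool)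
    (S : Stack → List Bool) :
    stepAux (pushWord k w q) s S = stepAux q s (Function.update S k (w.reverse ++ S k)) := by
  induction w generalizing S with
  | nil => simp [pushWord]
  | cons b w ih => simp [pushWord, ih]

@[simp] lemma stepAux_popCases {l : ℕ} (k : Stack) (t f n : Code l) (s : Option Bool)
    (S : Stack → List Bool) :
    stepAux (popCases k t f n) s S =
      stepAux (match (S k).head? with | some true => t | some false => f | none => n)
        (S k).head? (Function.update S k (S k).tail) := by
  rcases h : S k with _ | ⟨_ | _, _⟩ <;> simp [popCases, h]

/-! ### Runs of the machine, phase by phase -/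

variable {M c : ℕ} {D : List ℕ} {E : List Bool}

/-- A configuration of the machine. -/
abbrev Config (l : ℕ) := Cfg (fun _ : Stack => Bool) (Label l) (Option Bool)

/-- The machine takes exactly `t` steps from the first configuration to the second. -/
def Runs (M c : ℕ) (D : List ℕ) (E : List Bool) (t : ℕ) (x y : Config D.length) : Prop :=
  (flip bind (step (program M c D E)))^[t] (some x) = some y

lemma Runs.refl (x : Config D.length) : Runs M c D E 0 x x := rfl

lemma Runs.trans {t t' : ℕ} {x y z : Config D.length} (h : Runs M c D E t x y)
    (h' : Runs M c D E t' y z) : Runs M c D E (t + t') x z := by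
  rw [Runs, add_comm, Function.iterate_add_apply, show _ = _ from h]
  exact h'

lemma Runs.head {t : ℕ} {x y z : Config D.length}
    (h : step (program M c D E) x = some y) (h' : Runs M c D E t y z) :
    Runs M c D E (t + 1) x z := by
  rw [add_comm]
  exact Runs.trans (t := 1) h h'

open Instance (encodeNat)

/-- The effect of the multiplication by `M` on a word. -/
def scale (M : ℕ) (w : List Bool) : List Bool :=
  w.flatMap fun b => if b then List.replicate M true else [false]


lemma replicate_append_cons (n : ℕ) (b : Bool) (w : List Bool) :
    List.replicate n b ++ b :: w = b :: (List.replicate n b ++ w) := by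
  rw [← List.singleton_append, ← List.append_assoc, ← List.replicate_succ', List.replicate_succ,
    List.cons_append]

lemma reverse_encodeNat_add (m n : ℕ) :
    (encodeNat (m + n)).reverse = (encodeNat m).reverse ++ List.replicate n true := by
  simp [encodeNat]

/-- Each one read yields `M` ones and a mark on `cnt`; the final zero yields the summand `c`. The
output is built in reverse on `rev`. -/
lemma runs_order (n : ℕ) (w b r : List Bool) (s : Option Bool) :
    ∃ s', Runs M c D E (n + 1) ⟨some order, s, contents (encodeNat n ++ w) b [] r⟩
      ⟨some arcs, s', contents w (List.replicate n true ++ b) []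
        ((encodeNat (M * n + c)).reverse ++ r)⟩ := by
  induction n generalizing b r s with
  | zero =>
    refine ⟨some false, Runs.head ?_ (Runs.refl _)⟩
    simp [program, encodeNat]
  | succ n ih =>
    obtain ⟨s', h⟩ := ih (true :: b) (List.replicate M true ++ r) (some true)
    refine ⟨s', Runs.head ?_ (by
      convert! h using 3
      · simp [List.replicate_succ, replicate_append_cons]
      · rw [show M * (n + 1) + c = (M * n + c) + M by ring, reverse_encodeNat_add,
          List.append_assoc])⟩
    simp [program, encodeNat, List.replicate_succ]

lemma runs_arcs (w b r : List Bool) (s : Option Bool) :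
    Runs M c D E (w.length + 1) ⟨some arcs, s, contents w b [] r⟩
      ⟨some loop, none, contents [] b [] ((scale M w).reverse ++ r)⟩ := by
  induction w generalizing r s with
  | nil =>
    refine Runs.head ?_ (Runs.refl _)
    simp [program, scale]
  | cons x w ih =>
    cases x
    · refine Runs.head ?_ (by
        convert! ih (false :: r) (some false) using 3
        simp [scale])
      simp [program]
    · refine Runs.head ?_ (by
        convert! ih (List.replicate M true ++ r) (some true) using 3
        simp [scale])
      simp [program]

/-- Writing `M * i` in unary consumes the counter; `aux` saves it for the next offset. -/
lemma runs_up (j : Fin D.length) (i : ℕ) (x r : List Bool) (s : Option Bool) :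
    Runs M c D E (i + 1) ⟨some (up j), s, contents [] (List.replicate i true) x r⟩
      ⟨some (down j), none, contents [] [] (List.replicate i true ++ x)
        ((encodeNat (M * i + D[j])).reverse ++ r)⟩ := by
  induction i generalizing x r s with
  | zero =>
    refine Runs.head ?_ (Runs.refl _)
    simp [program]
  | succ i ih =>
    refine Runs.head ?_ (by
      convert! ih (true :: x) (List.replicate M true ++ r) (some true) using 3
      · simp [List.replicate_succ, replicate_append_cons]
      · rw [show M * (i + 1) + D[j] = (M * i + D[j]) + M by ring, reverse_encodeNat_add,
          List.append_assoc])
    simp [program, List.replicate_succ]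

lemma runs_down (j : Fin D.length) (i : ℕ) (b r : List Bool) (s : Option Bool) :
    Runs M c D E (i + 1) ⟨some (down j), s, contents [] b (List.replicate i true) r⟩
      ⟨some (enter D.length (j + 1)), none, contents [] (List.replicate i true ++ b) [] r⟩ := by
  induction i generalizing b s with
  | zero =>
    refine Runs.head ?_ (Runs.refl _)
    simp [program]
  | succ i ih =>
    refine Runs.head ?_ (by
      convert! ih (true :: b) (some true) using 3
      simp [List.replicate_succ, replicate_append_cons])
    simp [program, List.replicate_succ]

lemma runs_block (i k j : ℕ) (hj : j + k = D.length) (r : List Bool) (s : Option Bool) :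
    ∃ s', Runs M c D E (k * (2 * (i + 1)))
      ⟨some (enter D.length j), s, contents [] (List.replicate i true) [] r⟩
      ⟨some loop, s', contents [] (List.replicate i true) []
        (((D.drop j).flatMap fun d => encodeNat (M * i + d)).reverse ++ r)⟩ := by
  induction k generalizing j r s with
  | zero =>
    refine ⟨s, ?_⟩
    rw [List.drop_of_length_le (by omega)]
    simp only [zero_mul, enter, show ¬ j < D.length by omega, dite_false]
    exact Runs.refl _
  | succ k ih =>
    have hlt : j < D.length := by omega
    have h1 := runs_up (M := M) (c := c) (E := E) ⟨j, hlt⟩ i [] r s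
    have h2 := runs_down (M := M) (c := c) (E := E) ⟨j, hlt⟩ i []
      ((encodeNat (M * i + D[j])).reverse ++ r) none
    obtain ⟨s', h3⟩ := ih (j + 1) (by omega) ((encodeNat (M * i + D[j])).reverse ++ r) none
    refine ⟨s', ?_⟩
    have e : enter D.length j = up ⟨j, hlt⟩ := by simp [enter, hlt]
    rw [e, List.drop_eq_getElem_cons hlt,
      show (k + 1) * (2 * (i + 1)) = (i + 1) + (i + 1) + k * (2 * (i + 1)) by ring]
    simp only [List.append_nil] at h1 h2
    have h := (h1.trans h2).trans h3
    simp only [List.flatMap_cons, List.reverse_append, List.append_assoc]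
    exact h

/-- The numbers that the machine writes after the scaled arcs, as a word. -/
def blocks (M : ℕ) (D : List ℕ) (n : ℕ) : List Bool :=
  (List.range n).reverse.flatMap fun i => D.flatMap fun d => encodeNat (M * i + d)

/-- The counter is popped before each block, so the blocks come for `n - 1, …, 0`, whence the
reversed range in `blocks`. -/
lemma runs_loop (n : ℕ) (r : List Bool) (s : Option Bool) :
    ∃ t ≤ n * (1 + D.length * (2 * n)) + 1, Runs M c D E t
      ⟨some loop, s, contents [] (List.replicate n true) [] r⟩
      ⟨some flush, none, contents [] [] [] ((blocks M D n ++ E).reverse ++ r)⟩ := by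
  induction n generalizing r s with
  | zero =>
    refine ⟨1, by simp, Runs.head ?_ (Runs.refl _)⟩
    simp [program, blocks]
  | succ n ih =>
    obtain ⟨s', h1⟩ := runs_block (M := M) (c := c) (E := E) n D.length 0 (zero_add _) r (some true)
    obtain ⟨t, ht, h2⟩ := ih (((D.drop 0).flatMap fun d => encodeNat (M * n + d)).reverse ++ r) s'
    refine ⟨D.length * (2 * (n + 1)) + t + 1, ?_, Runs.head ?_ (by
      convert! h1.trans h2 using 3
      simp [blocks, List.range_succ])⟩
    · have : n * (1 + D.length * (2 * n)) ≤ n * (1 + D.length * (2 * (n + 1))) := by gcongr; simp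
      calc _ ≤ D.length * (2 * (n + 1)) + (n * (1 + D.length * (2 * (n + 1))) + 1) + 1 := by omega
        _ = _ := by ring
    · simp [program, List.replicate_succ]

/-- The last pop finds an empty stack and resets the internal state to `none`, as the halting
configuration demands. -/
lemma runs_flush (w a : List Bool) (s : Option Bool) :
    Runs M c D E (w.length + 1) ⟨some flush, s, contents a [] [] w⟩
      ⟨none, none, contents (w.reverse ++ a) [] [] []⟩ := by
  induction w generalizing a s with
  | nil =>
    refine Runs.head ?_ (Runs.refl _)
    simp [program]
  | cons x w ih =>
    cases x
    · refine Runs.head ?_ (by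
        convert! ih (false :: a) (some false) using 3
        simp)
      simp [program]
    · refine Runs.head ?_ (by
        convert! ih (true :: a) (some true) using 3
        simp)
      simp [program]

/-- The output of the machine. -/
def output (M c : ℕ) (D : List ℕ) (E : List Bool) (n : ℕ) (w : List Bool) : List Bool :=
  encodeNat (M * n + c) ++ scale M w ++ (blocks M D n ++ E)

lemma runs_program (n : ℕ) (w : List Bool) :
    ∃ t ≤ (n + 1) + (w.length + 1) + (n * (1 + D.length * (2 * n)) + 1) +
        ((output M c D E n w).length + 1),
      Runs M c D E t ⟨some order, none, contents (encodeNat n ++ w) [] [] []⟩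
        ⟨none, none, contents (output M c D E n w) [] [] []⟩ := by
  obtain ⟨s, h1⟩ := runs_order (M := M) (c := c) (D := D) (E := E) n w [] [] none
  have h2 := runs_arcs (M := M) (c := c) (D := D) (E := E) w (List.replicate n true)
    (encodeNat (M * n + c)).reverse s
  obtain ⟨t, ht, h3⟩ := runs_loop (M := M) (c := c) (D := D) (E := E) n
    ((scale M w).reverse ++ (encodeNat (M * n + c)).reverse) none
  have h4 := runs_flush (M := M) (c := c) (D := D) (E := E) (output M c D E n w).reverse [] none
  refine ⟨n + 1 + (w.length + 1) + t + ((output M c D E n w).reverse.length + 1), by simpa, ?_⟩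
  simp only [List.append_nil, List.reverse_reverse] at h1 h2 h3 h4
  refine ((h1.trans h2).trans h3).trans ?_
  convert! h4 using 3
  simp [output]

/-! ### Polynomial bounds and the bundled machine -/

lemma length_scale_le (w : List Bool) : (scale M w).length ≤ (M + 1) * w.length := by
  induction w with
  | nil => simp [scale]
  | cons x w ih =>
    have : (scale M (x :: w)).length ≤ M + 1 + (scale M w).length := by cases x <;> simp [scale]
    rw [List.length_cons]
    linarith

lemma length_blocks_le (n : ℕ) :
    (blocks M D n).length ≤ n * (D.length * (M * n + 1) + D.sum) := by
  have key : ∀ i, i ≤ n → (D.flatMap fun d => encodeNat (M * i + d)).length ≤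
      D.length * (M * n + 1) + D.sum := by
    intro i hi
    have : M * i ≤ M * n := Nat.mul_le_mul_left _ hi
    induction D with
    | nil => simp
    | cons d D ih =>
      simp only [List.flatMap_cons, List.length_append, List.length_cons, List.sum_cons,
        encodeNat, List.length_replicate, List.length_nil] at ih ⊢
      linarith
  -- The bound per block uses `n`, not `k`, so it stays constant along the induction.
  have : ∀ k ≤ n, (blocks M D k).length ≤ k * (D.length * (M * n + 1) + D.sum) := by
    intro k hk
    induction k with
    | zero => simp [blocks]
    | succ k ih =>
      have e : blocks M D (k + 1) = (D.flatMap fun d => encodeNat (M * k + d)) ++ blocks M D k := by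
        simp [blocks, List.range_succ]
      rw [e, List.length_append]
      linarith [ih (by omega), key k (by omega)]
  exact this n le_rfl

/-- The machine, bundled. -/
def machine (M c : ℕ) (D : List ℕ) (E : List Bool) : Turing.FinTM2 where
  K := Stack
  k₀ := inp
  k₁ := inp
  Γ _ := Bool
  Λ := Label D.length
  main := order
  σ := Option Bool
  initialState := none
  m := program M c D E

lemma initList_machine (w : List Bool) :
    Turing.initList (machine M c D E) w = ⟨some order, none, contents w [] [] []⟩ := by
  refine congrArg (Cfg.mk _ _) ?_
  funext k
  cases k <;> rfl

lemma haltList_machine (w : List Bool) :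
    Turing.haltList (machine M c D E) w = ⟨none, none, contents w [] [] []⟩ := by
  refine congrArg (Cfg.mk _ _) ?_
  funext k
  cases k <;> rfl

open Polynomial in
/-- A polynomial bound for the running time of the machine. -/
noncomputable def timeBound (M c : ℕ) (D : List ℕ) (E : List Bool) : ℕ[X] :=
  (X + 1) + (X + 1) + (X * (1 + C D.length * (2 * X)) + 1) +
    ((C M * X + C c + 1) + C (M + 1) * X +
      (X * (C D.length * (C M * X + 1) + C D.sum) + C E.length) + 1)

end Transducer

open Transducer in
/-- A transformation of instances that multiplies the numbers of all vertices by `M` and adds, for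
every vertex, a shifted copy of a fixed list of arcs, as well as one more fixed list of arcs, is
computable in polynomial time. -/
theorem nonempty_tm2ComputableInPolyTime (f : Instance → Instance) (M c : ℕ)
    (L L₀ : List (ℕ × ℕ)) (horder : ∀ G, (f G).order = M * G.order + c)
    (harcs : ∀ G, (f G).arcs = G.arcs.map (fun a => (M * a.1, M * a.2)) ++
      ((List.range G.order).reverse.flatMap fun i => L.map fun a => (M * i + a.1, M * i + a.2)) ++
      L₀) :
    Nonempty (Turing.TM2ComputableInPolyTime Instance.encode Instance.encode f) := by
  set D : List ℕ := L.flatMap fun a => [a.1, a.2] with hD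
  set E : List Bool := L₀.flatMap Instance.encodeArc with hE
  have hout : ∀ G : Instance, Instance.encode (f G) =
      output M c D E G.order (G.arcs.flatMap Instance.encodeArc) := by
    intro G
    have h1 : ∀ l : List (ℕ × ℕ), (l.map fun a => (M * a.1, M * a.2)).flatMap Instance.encodeArc =
        scale M (l.flatMap Instance.encodeArc) := by
      intro l
      have hn : ∀ k, Instance.encodeNat (M * k) = scale M (Instance.encodeNat k) := by
        intro k
        have : ∀ k, scale M (List.replicate k true) = List.replicate (M * k) true := by
          intro k
          induction k with
          | zero => rfl
          | succ k ih =>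
            rw [List.replicate_succ, Nat.mul_succ, add_comm, List.replicate_add, ← ih]
            simp [scale]
        rw [Instance.encodeNat, Instance.encodeNat, ← this]
        simp [scale]
      simp only [scale] at hn ⊢
      simp [List.flatMap_map, Instance.encodeArc, hn, List.flatMap_assoc]
    have h2 : ∀ i, (L.map fun a => (M * i + a.1, M * i + a.2)).flatMap Instance.encodeArc =
        D.flatMap fun d => Instance.encodeNat (M * i + d) := by
      intro i
      simp [hD, List.flatMap_map, List.flatMap_assoc, Instance.encodeArc]
    rw [Instance.encode, horder, harcs, output, blocks, List.flatMap_append, List.flatMap_append,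
      h1, List.flatMap_assoc]
    simp only [h2, List.append_assoc, hE]
  refine ⟨⟨⟨machine M c D E, Equiv.refl Bool, Equiv.refl Bool⟩, timeBound M c D E, fun G => ?_⟩⟩
  have h := runs_program (M := M) (c := c) (D := D) (E := E) G.order
    (G.arcs.flatMap Instance.encodeArc)
  rw [← hout] at h
  refine ⟨⟨h.choose, ?_⟩, h.choose_spec.1.trans ?_⟩
  · have := h.choose_spec.2
    rw [Runs] at this
    simp only [Equiv.invFun_as_coe, Equiv.refl_symm, Equiv.coe_refl, Option.map_some]
    erw [List.map_id, List.map_id, initList_machine, haltList_machine]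
    exact this
  · set w := G.arcs.flatMap Instance.encodeArc with hw
    have hlen : (Instance.encode G).length = G.order + 1 + w.length := by
      simp only [Instance.encode, Instance.encodeNat, List.length_append, List.length_replicate,
        List.length_singleton, hw]
    have h1 : G.order ≤ (Instance.encode G).length := by omega
    have h2 : w.length ≤ (Instance.encode G).length := by omega
    -- Only `G.order ≤ X` and `w.length ≤ X` matter from here on: every bound is monotone in both.
    generalize (Instance.encode G).length = X at h1 h2 ⊢
    simp only [timeBound, Polynomial.eval_add, Polynomial.eval_mul, Polynomial.eval_X,
      Polynomial.eval_C, Polynomial.eval_one, Polynomial.eval_ofNat]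
    rw [hout]
    have h3 : (output M c D E G.order w).length ≤ (M * X + c + 1) + (M + 1) * X +
        (X * (D.length * (M * X + 1) + D.sum) + E.length) := by
      rw [output]
      simp only [List.length_append, Instance.encodeNat, List.length_replicate, List.length_singleton]
      refine Nat.add_le_add (Nat.add_le_add ?_ ((length_scale_le w).trans (by gcongr)))
        (Nat.add_le_add_right ((length_blocks_le _).trans (by gcongr)) _)
      gcongr
    gcongr

end IotHom
-- The gadget graph and its adjacencies
namespace IotHom

/-- The vertices of the gadget graph: the vertices `y i` of the given graph, and two vertices
`w j u` and `z j u` for every layer `j` and every vertex `u` of the target. -/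
inductive GadgetVertex (V : Type*)
  | y (i : ℕ)
  | w (j : ℕ) (u : V)
  | z (j : ℕ) (u : V)

namespace Gadget

open GadgetVertex

variable {V : Type*} (T : Digraph V) (v : V) (out : Bool)

/-- The strict out- or in-neighbourhood of `v`. -/
def nbhd : Set V := if out then strictOutNbhd T v else strictInNbhd T v

variable {T v out} in
lemma mem_nbhd {u : V} :
    u ∈ nbhd T v out ↔ u ≠ v ∧ (out = true → T.Adj v u) ∧ (out = false → T.Adj u v) := by
  cases out <;> simp [nbhd, strictOutNbhd, strictInNbhd, outNbhd, inNbhd, and_comm]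

/-- The arcs that have an end `z j u` with `j / 2 = i`. -/
def Link (i : ℕ) : GadgetVertex V → GadgetVertex V → Prop
  | w j u, z k u' => k / 2 = i ∧
      (j = k ∧ u = u' ∨ j = k + 1 ∧ u ≠ u' ∧ ¬ (Even k ∧ u' = v) ∧ T.Adj u u')
  | z k u, w j u' => k / 2 = i ∧ j = k + 1 ∧ u ≠ u' ∧ ¬ (Even k ∧ u = v) ∧ T.Adj u u'
  | z k u, y l => out = true ∧ k = 2 * i ∧ u = v ∧ l = i
  | y l, z k u => out = false ∧ k = 2 * i ∧ u = v ∧ l = i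
  | _, _ => False

/-- The arcs between the vertices `w 0 u`: a copy of the target without its loops. -/
def Base : GadgetVertex V → GadgetVertex V → Prop
  | w j u, w k u' => j = 0 ∧ k = 0 ∧ u ≠ u' ∧ T.Adj u u'
  | _, _ => False

/-- The arcs of the given graph. -/
def Orig (V : Type*) (G : Instance) : GadgetVertex V → GadgetVertex V → Prop
  | y i, y k => (i, k) ∈ G.arcs
  | _, _ => False

/-- The gadget graph, on an infinite set of vertices almost all of which are isolated. -/
def graph (G : Instance) : Digraph (GadgetVertex V) :=
  ⟨fun a b => Orig V G a b ∨ (∃ i < G.order, Link T v out i a b) ∨ Base T a b⟩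

section Adjacency

variable {T v out} {G : Instance} {i j k : ℕ} {u u' : V}

@[simp] lemma adj_y_y : (graph T v out G).Adj (y i) (y k) ↔ (i, k) ∈ G.arcs := by
  simp [graph, Orig, Link, Base]

@[simp] lemma adj_y_w : ¬ (graph T v out G).Adj (y i) (w k u) := by
  simp [graph, Orig, Link, Base]

@[simp] lemma adj_w_y : ¬ (graph T v out G).Adj (w k u) (y i) := by
  simp [graph, Orig, Link, Base]

@[simp] lemma adj_y_z : (graph T v out G).Adj (y i) (z k u) ↔
    i < G.order ∧ out = false ∧ k = 2 * i ∧ u = v := by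
  simp only [graph, Orig, Link, Base, false_or, or_false]
  constructor
  · rintro ⟨i, hi, h, rfl, rfl, rfl⟩
    exact ⟨hi, h, rfl, rfl⟩
  · rintro ⟨hi, h, rfl, rfl⟩
    exact ⟨i, hi, h, rfl, rfl, rfl⟩

@[simp] lemma adj_z_y : (graph T v out G).Adj (z k u) (y i) ↔
    i < G.order ∧ out = true ∧ k = 2 * i ∧ u = v := by
  simp only [graph, Orig, Link, Base, false_or, or_false]
  constructor
  · rintro ⟨i, hi, h, rfl, rfl, rfl⟩
    exact ⟨hi, h, rfl, rfl⟩
  · rintro ⟨hi, h, rfl, rfl⟩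
    exact ⟨i, hi, h, rfl, rfl, rfl⟩

@[simp] lemma adj_w_w : (graph T v out G).Adj (w j u) (w k u') ↔
    j = 0 ∧ k = 0 ∧ u ≠ u' ∧ T.Adj u u' := by
  simp [graph, Orig, Link, Base]

@[simp] lemma adj_z_z : ¬ (graph T v out G).Adj (z j u) (z k u') := by
  simp [graph, Orig, Link, Base]

@[simp] lemma adj_w_z : (graph T v out G).Adj (w j u) (z k u') ↔ k < 2 * G.order ∧
    (j = k ∧ u = u' ∨ j = k + 1 ∧ u ≠ u' ∧ ¬ (Even k ∧ u' = v) ∧ T.Adj u u') := by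
  simp only [graph, Orig, Link, Base, false_or, or_false]
  constructor
  · rintro ⟨i, hi, h, h'⟩
    exact ⟨by omega, h'⟩
  · rintro ⟨hi, h⟩
    exact ⟨k / 2, by omega, rfl, h⟩

@[simp] lemma adj_z_w : (graph T v out G).Adj (z k u) (w j u') ↔ k < 2 * G.order ∧
    j = k + 1 ∧ u ≠ u' ∧ ¬ (Even k ∧ u = v) ∧ T.Adj u u' := by
  simp only [graph, Orig, Link, Base, false_or, or_false]
  constructor
  · rintro ⟨i, hi, h, h'⟩
    exact ⟨by omega, h'⟩
  · rintro ⟨hi, h⟩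
    exact ⟨k / 2, by omega, rfl, h⟩

lemma graph_isOriented (hT : IsOriented T) : IsOriented (graph T v out G) := by
  rintro (i | ⟨j, u⟩ | ⟨j, u⟩) (k | ⟨k, u'⟩ | ⟨k, u'⟩) hne h h'
  · simp only [adj_y_y] at h h'
    exact G.oriented i k (fun e => hne (by rw [e])) h h'
  · simp at h
  · simp only [adj_y_z, adj_z_y] at h h'
    simp [h.2.1] at h'
  · simp at h
  · simp only [adj_w_w] at h h'
    exact hT _ _ h.2.2.1 h.2.2.2 h'.2.2.2
  · simp only [adj_w_z, adj_z_w] at h h'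
    rcases h.2 with h2 | h2
    · omega
    · exact hT _ _ h2.2.1 h2.2.2.2 h'.2.2.2.2
  · simp only [adj_y_z, adj_z_y] at h h'
    simp [h.2.1] at h'
  · simp only [adj_w_z, adj_z_w] at h h'
    rcases h'.2 with h2 | h2
    · omega
    · exact hT _ _ h2.2.1 h2.2.2.2 h.2.2.2.2
  · simp at h

lemma loop_of_graph_adj_self {a : GadgetVertex V} (h : (graph T v out G).Adj a a) :
    ∃ i, (i, i) ∈ G.arcs := by
  rcases a with (i | ⟨j, u⟩ | ⟨j, u⟩)
  · exact ⟨i, by simpa using h⟩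
  · simp at h
  · simp at h

end Adjacency

/-! ### Extending a homomorphism over the gadget -/

section Backward

variable {T v out} {G : Instance}

/-- The homomorphism from the gadget graph that extends a given map. -/
def extension (v : V) {S : Set V} {n : ℕ} (g : Fin n → S) : GadgetVertex V → V
  | y i => if h : i < n then g ⟨i, h⟩ else v
  | w _ u => u
  | z _ u => u

/-- No neighbourhood repeats a value. A vertex `w j u` sees the value `u` only at `z j u`, and other
values in layer 0 (if `j = 0`) or among the `z (j - 1) u'`. At `y i` and `z (2 * i) v`, the values
of `g` avoid `v`. -/
lemma isIotInjectiveHom_extension (hT : IsReflexiveTournament T) {g : Fin G.order → nbhd T v out}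
    (hg : IsIotInjectiveHom G.graph (induced T (nbhd T v out)) g) :
    IsIotInjectiveHom (graph T v out G) T (extension v g) := by
  have hS : ∀ i, (g i : V) ≠ v := fun i => (mem_nbhd.1 (g i).2).1
  constructor
  · rintro (i | ⟨j, u⟩ | ⟨j, u⟩) (k | ⟨k, u'⟩ | ⟨k, u'⟩) h
    · rw [adj_y_y] at h
      obtain ⟨hi, hk⟩ := G.arcs_lt _ h
      simp only [extension, show i < G.order from hi, show k < G.order from hk, dite_true]
      exact hg.map_adj ⟨i, hi⟩ ⟨k, hk⟩ h
    · simp at h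
    · obtain ⟨hi, ho, -, rfl⟩ := adj_y_z.1 h
      simp only [extension, hi, dite_true]
      exact (mem_nbhd.1 (g ⟨i, hi⟩).2).2.2 ho
    · simp at h
    · exact (adj_w_w.1 h).2.2.2
    · obtain ⟨-, ⟨-, rfl⟩ | h⟩ := adj_w_z.1 h
      · exact hT.refl _
      · exact h.2.2.2
    · obtain ⟨hi, ho, -, rfl⟩ := adj_z_y.1 h
      simp only [extension, hi, dite_true]
      exact (mem_nbhd.1 (g ⟨k, hi⟩).2).2.1 ho
    · exact (adj_z_w.1 h).2.2.2.2
    · simp at h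
  · rintro x a ha b hb hab
    simp only [Set.mem_union, outNbhd, inNbhd, Set.mem_ofPred_eq] at ha hb
    rcases x with (i | ⟨j, u⟩ | ⟨j, u⟩)
    · rcases a with (k | ⟨k, u'⟩ | ⟨k, u'⟩) <;> rcases b with (l | ⟨l, u''⟩ | ⟨l, u''⟩) <;>
        simp only [adj_y_y, adj_y_z, adj_z_y, adj_y_w, adj_w_y, or_self] at ha hb
      · have hi : i < G.order := by rcases ha with h | h; exacts [(G.arcs_lt _ h).1, (G.arcs_lt _ h).2]
        have hk : k < G.order := by rcases ha with h | h; exacts [(G.arcs_lt _ h).2, (G.arcs_lt _ h).1]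
        have hl : l < G.order := by rcases hb with h | h; exacts [(G.arcs_lt _ h).2, (G.arcs_lt _ h).1]
        simp only [extension, hk, hl, dite_true] at hab
        have := hg.injOn ⟨i, hi⟩ (x₁ := ⟨k, hk⟩) (x₂ := ⟨l, hl⟩) ha hb (Subtype.ext hab)
        simpa using this
      · have hk : k < G.order := by rcases ha with h | h; exacts [(G.arcs_lt _ h).2, (G.arcs_lt _ h).1]
        have hu : u'' = v := by rcases hb with h | h; exacts [h.2.2.2, h.2.2.2]
        simp only [extension, hk, dite_true, hu] at hab
        exact absurd hab (hS _)
      · have hk : l < G.order := by rcases hb with h | h; exacts [(G.arcs_lt _ h).2, (G.arcs_lt _ h).1]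
        have hu : u' = v := by rcases ha with h | h; exacts [h.2.2.2, h.2.2.2]
        simp only [extension, hk, dite_true, hu] at hab
        exact absurd hab.symm (hS _)
      · simp only [extension] at hab
        subst hab
        have h1 : k = 2 * i := by rcases ha with h | h; exacts [h.2.2.1, h.2.2.1]
        have h2 : l = 2 * i := by rcases hb with h | h; exacts [h.2.2.1, h.2.2.1]
        rw [h1, h2]
    · rcases a with (k | ⟨k, u'⟩ | ⟨k, u'⟩) <;> rcases b with (l | ⟨l, u''⟩ | ⟨l, u''⟩) <;>
        try simp only [adj_y_w, adj_w_y, or_self] at ha hb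
      all_goals
        simp only [extension] at hab
        subst hab
        simp only [adj_w_w, adj_w_z, adj_z_w] at ha hb
        simp only [w.injEq, z.injEq, and_true, reduceCtorEq]
        grind
    · rcases a with (k | ⟨k, u'⟩ | ⟨k, u'⟩) <;> rcases b with (l | ⟨l, u''⟩ | ⟨l, u''⟩) <;>
        try simp only [adj_z_z, or_self] at ha hb
      · simp only [adj_y_z, adj_z_y] at ha hb
        have : k = l := by omega
        rw [this]
      · simp only [adj_y_z, adj_z_y] at ha
        have hk : k < G.order := by rcases ha with h | h; exacts [h.1, h.1]
        have hj : j = 2 * k ∧ u = v := by rcases ha with h | h; exacts [h.2.2, h.2.2]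
        simp only [extension, hk, dite_true] at hab
        simp only [adj_w_z, adj_z_w] at hb
        have := hS ⟨k, hk⟩
        -- As `j` is even and `u = v`, the only `w`-neighbour is `w j v`, with value `v`, while the
        -- values of `g` differ from `v`.
        grind
      · simp only [adj_y_z, adj_z_y] at hb
        have hk : l < G.order := by rcases hb with h | h; exacts [h.1, h.1]
        have hj : j = 2 * l ∧ u = v := by rcases hb with h | h; exacts [h.2.2, h.2.2]
        simp only [extension, hk, dite_true] at hab
        simp only [adj_w_z, adj_z_w] at ha
        have := hS ⟨l, hk⟩
        grind
      · simp only [extension] at hab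
        subst hab
        simp only [adj_w_z, adj_z_w] at ha hb
        simp only [w.injEq, and_true]
        grind

end Backward

/-! ### Rigidity of the gadget -/

section Forward

variable {T v out} {G : Instance} {φ : GadgetVertex V → V}

lemma exists_ne_three [Finite V] (hV : 4 ≤ Nat.card V) (a b c : V) :
    ∃ u, u ≠ a ∧ u ≠ b ∧ u ≠ c := by
  classical
  have := Fintype.ofFinite V
  have : ({a, b, c} : Finset V).card < Fintype.card V := by
    rw [← Nat.card_eq_fintype_card]
    exact lt_of_le_of_lt Finset.card_le_three hV
  obtain ⟨u, hu⟩ := Finset.exists_mem_notMem_of_card_lt_card (t := Finset.univ) (by simpa using this)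
  exact ⟨u, by simpa using hu.2⟩

lemma _root_.IotHom.IsIotInjectiveHom.ne (hφ : IsIotInjectiveHom (graph T v out G) T φ)
    {x a b : GadgetVertex V}
    (ha : (graph T v out G).Adj x a ∨ (graph T v out G).Adj a x)
    (hb : (graph T v out G).Adj x b ∨ (graph T v out G).Adj b x) (hab : a ≠ b) : φ a ≠ φ b :=
  fun h => hab (hφ.injOn x ha hb h)

variable (hT : IsReflexiveTournament T) (hV : 4 ≤ Nat.card V)
  (hφ : IsIotInjectiveHom (graph T v out G) T φ)

section
include hT

lemma link_w_w {u u' : V} (h : u ≠ u') :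
    (graph T v out G).Adj (w 0 u) (w 0 u') ∨ (graph T v out G).Adj (w 0 u') (w 0 u) := by
  rcases hT.total u u' h with h' | h'
  · exact .inl (by simp [h, h'])
  · exact .inr (by simp [h.symm, h'])

lemma link_w_z {k : ℕ} (hk : k < 2 * G.order) {u u' : V} (h : u ≠ u') (hv : ¬ (Even k ∧ u' = v)) :
    (graph T v out G).Adj (w (k + 1) u) (z k u') ∨
      (graph T v out G).Adj (z k u') (w (k + 1) u) := by
  rcases hT.total u u' h with h' | h'
  · exact .inl (adj_w_z.2 ⟨hk, .inr ⟨rfl, h, hv, h'⟩⟩)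
  · exact .inr (adj_z_w.2 ⟨hk, rfl, h.symm, hv, h'⟩)

end

lemma link_w_z_self {k : ℕ} (hk : k < 2 * G.order) (u : V) :
    (graph T v out G).Adj (w k u) (z k u) ∨ (graph T v out G).Adj (z k u) (w k u) :=
  .inl (adj_w_z.2 ⟨hk, .inl ⟨rfl, rfl⟩⟩)

variable [Finite V]

section
include hT hV hφ

lemma injective_layer_zero : Function.Injective fun u => φ (w 0 u) := by
  intro a b hab
  by_contra hne
  obtain ⟨u, ha, hb, -⟩ := exists_ne_three hV a b b
  exact hφ.ne (link_w_w hT ha) (link_w_w hT hb) (by simpa using hne) hab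

lemma surjective_layer_zero : Function.Surjective fun u => φ (w 0 u) :=
  Finite.injective_iff_surjective.1 (injective_layer_zero hT hV hφ)

/-- Layer 0 takes every value, so a value is identified by exclusion. This is how the automorphism
spreads to all other layers. -/
lemma eq_of_forall_ne {a u : V} (h : ∀ u' ≠ u, φ (w 0 u') ≠ a) : a = φ (w 0 u) := by
  obtain ⟨x, rfl⟩ := surjective_layer_zero hT hV hφ a
  by_contra hne
  exact h x (fun e => hne (by rw [e])) rfl

lemma apply_w {j : ℕ} (hj : j ≤ 2 * G.order) (u : V) : φ (w j u) = φ (w 0 u) := by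
  induction j generalizing u with
  | zero => rfl
  | succ j ih =>
    have hj' : j < 2 * G.order := hj
    replace ih := fun u => ih hj'.le u
    -- The common neighbour is `z j u`, whose links to layer `j + 1` are sure to exist only for `u ≠
    -- v`.
    have h1 : ∀ u u', u ≠ v → u' ≠ u → φ (w (j + 1) u') ≠ φ (w 0 u) := by
      intro u u' hu hu'
      rw [← ih u]
      exact hφ.ne (link_w_z hT hj' hu' (by simp [hu])).symm (link_w_z_self hj' u).symm (by simp)
    have h2 : Function.Injective fun u => φ (w (j + 1) u) := by
      intro a b hab
      by_contra hne
      -- Four vertices are needed here: the common neighbour `z j u` must avoid `v` as well as `a`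
      -- and `b`.
      obtain ⟨u, ha, hb, hv⟩ := exists_ne_three hV a b v
      exact hφ.ne (link_w_z hT hj' ha.symm (by simp [hv])).symm
        (link_w_z hT hj' hb.symm (by simp [hv])).symm (by simpa using hne) hab
    have h3 : ∀ u, u ≠ v → φ (w (j + 1) u) = φ (w 0 u) := by
      intro u hu
      obtain ⟨x, hx⟩ := Finite.injective_iff_surjective.1 h2 (φ (w 0 u))
      by_cases hxu : x = u
      · rw [← hxu] at hx ⊢
        exact hx
      · exact absurd hx (h1 u x hu hxu)
    -- The value at `v` is the only one left over.
    by_cases hu : u = v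
    · subst hu
      refine eq_of_forall_ne hT hV hφ fun u' hu' => ?_
      rw [← h3 u' hu']
      exact h2.ne hu'
    · exact h3 u hu

/-- The vertex `w (k + 1) u` compares `z (k + 1) u` with all `z k u'`, `u' ≠ u`, except `z k v` when
`k` is even. The induction passes through the odd layer, where this missing comparison is recovered.
-/
lemma apply_z {i : ℕ} (hi : i < G.order) (u : V) : φ (z (2 * i) u) = φ (w 0 u) := by
  induction i generalizing u with
  | zero =>
    refine eq_of_forall_ne hT hV hφ fun u' hu' => ?_
    exact hφ.ne (link_w_w hT hu'.symm) (link_w_z_self (by omega) u) (by simp)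
  | succ i ih =>
    replace ih := fun u => ih (by omega) u
    have hW : ∀ j ≤ 2 * G.order, ∀ u, φ (w j u) = φ (w 0 u) := fun j hj => apply_w hT hV hφ hj
    have hodd : ∀ u, ¬ (Even (2 * i + 1) ∧ u = v) := fun u h => by
      have := h.1
      grind
    -- For `v` itself nothing is missing: the comparison needs only `u' ≠ v`.
    have hv : φ (z (2 * i + 1) v) = φ (w 0 v) := by
      refine eq_of_forall_ne hT hV hφ fun u' hu' => ?_
      rw [← ih u']
      exact hφ.ne (link_w_z hT (by omega) hu'.symm (by simp [hu'])) (link_w_z_self (by omega) v)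
        (by simp)
    have hinj : ∀ a b, a ≠ b → φ (z (2 * i + 1) a) ≠ φ (z (2 * i + 1) b) := by
      intro a b hne
      obtain ⟨u, ha, hb, -⟩ := exists_ne_three hV a b b
      exact hφ.ne (link_w_z hT (by omega) ha (hodd _)) (link_w_z hT (by omega) hb (hodd _))
        (by simpa using hne)
    have hz : ∀ u, φ (z (2 * i + 1) u) = φ (w 0 u) := by
      intro u
      refine eq_of_forall_ne hT hV hφ fun u' hu' => ?_
      -- The missing comparison with `z (2 * i) v` is replaced by one with `z (2 * i + 1) v`, whose
      -- value is already known.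
      by_cases h : u' = v
      · rw [h, ← hv]
        exact hinj _ _ (h ▸ hu')
      · rw [← ih u']
        exact hφ.ne (link_w_z hT (by omega) hu'.symm (by simp [h])) (link_w_z_self (by omega) u)
          (by simp)
    refine eq_of_forall_ne hT hV hφ fun u' hu' => ?_
    rw [← hz u']
    exact hφ.ne (link_w_z hT (by omega) hu'.symm (hodd _)) (link_w_z_self (by omega) u)
      (by simp; omega)

/-- An injective arc-preserving map of a tournament reflects arcs, since a reversed arc would yield
a 2-cycle. -/
lemma adj_of_adj_layer_zero {a b : V} (h : T.Adj (φ (w 0 a)) (φ (w 0 b))) : T.Adj a b := by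
  by_cases hab : a = b
  · subst hab
    exact hT.refl a
  · refine (hT.total a b hab).resolve_right fun h' => ?_
    have h2 : T.Adj (φ (w 0 b)) (φ (w 0 a)) :=
      hφ.map_adj _ _ (adj_w_w.2 ⟨rfl, rfl, Ne.symm hab, h'⟩)
    exact hT.oriented _ _ ((injective_layer_zero hT hV hφ).ne hab) h h2

lemma exists_isIotInjectiveHom_of_gadget :
    ∃ g : Fin G.order → nbhd T v out, IsIotInjectiveHom G.graph (induced T (nbhd T v out)) g := by
  -- `ψ` is the inverse of the automorphism given by layer 0.
  choose ψ hψ using surjective_layer_zero hT hV hφ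
  have hadj : ∀ a b, T.Adj a b → T.Adj (ψ a) (ψ b) := fun a b h =>
    adj_of_adj_layer_zero hT hV hφ (by simpa only [hψ] using h)
  have hmem : ∀ i : Fin G.order, ψ (φ (y i)) ∈ nbhd T v out := by
    intro i
    have hz : φ (z (2 * i) v) = φ (w 0 v) := apply_z hT hV hφ i.2 v
    have hw : φ (w (2 * i) v) = φ (w 0 v) := apply_w hT hV hφ (by omega) v
    have hy : (graph T v out G).Adj (z (2 * i) v) (y i) ∨
        (graph T v out G).Adj (y i) (z (2 * i) v) := by
      cases out <;> simp
    refine mem_nbhd.2 ⟨fun h => ?_, fun ho => ?_, fun ho => ?_⟩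
    -- Both `y i` and `w (2 * i) v` are neighbours of `z (2 * i) v`; this makes the neighbourhood
    -- strict.
    · have hne := hφ.ne hy (link_w_z_self (by omega) v).symm (by simp)
      rw [hw, ← hψ (φ (y i))] at hne
      exact hne (by simp only [h])
    · refine adj_of_adj_layer_zero hT hV hφ ?_
      have := hφ.map_adj _ _ (adj_z_y.2 ⟨i.2, ho, rfl, rfl⟩)
      rw [hz] at this
      simpa only [hψ] using this
    · refine adj_of_adj_layer_zero hT hV hφ ?_
      have := hφ.map_adj _ _ (adj_y_z.2 ⟨i.2, ho, rfl, rfl⟩)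
      rw [hz] at this
      simpa only [hψ] using this
  refine ⟨fun i => ⟨ψ (φ (y i)), hmem i⟩, fun i k h => ?_, fun u a ha b hb hab => ?_⟩
  · exact hadj _ _ (hφ.map_adj _ _ (adj_y_y.2 h))
  · have h1 : φ (y a) = φ (y b) := by
      rw [← hψ (φ (y a)), ← hψ (φ (y b))]
      exact congrArg (fun x => φ (w 0 x)) (congrArg Subtype.val hab)
    have h2 := hφ.injOn (y u) (x₁ := y a) (x₂ := y b) (ha.imp adj_y_y.2 adj_y_y.2)
      (hb.imp adj_y_y.2 adj_y_y.2) h1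
    exact Fin.ext (by simpa using h2)

end

/-- The gadget graph has a homomorphism to the target if and only if the given graph has one to
the neighbourhood. -/
theorem exists_isIotInjectiveHom_iff (hT : IsReflexiveTournament T) (hV : 4 ≤ Nat.card V) :
    (∃ φ, IsIotInjectiveHom (graph T v out G) T φ) ↔
      ∃ g : Fin G.order → nbhd T v out, IsIotInjectiveHom G.graph (induced T (nbhd T v out)) g :=
  ⟨fun ⟨_, hφ⟩ => exists_isIotInjectiveHom_of_gadget hT hV hφ,
    fun ⟨_, hg⟩ => ⟨_, isIotInjectiveHom_extension hT hg⟩⟩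

end Forward

end Gadget

end IotHom
-- Numbering the gadget graph as an instance
namespace IotHom

namespace Gadget

open GadgetVertex

variable {V : Type*} {m : ℕ} (e : V ≃ Fin m)

/-- The number of a vertex of the gadget graph. -/
def code : GadgetVertex V → ℕ
  | y i => (2 * m + 1) * (2 * i)
  | w j u => (2 * m + 1) * j + (1 + e u)
  | z j u => (2 * m + 1) * j + (1 + m + e u)

lemma mul_add_inj {K j j' r r' : ℕ} (hr : r < K) (hr' : r' < K) (h : K * j + r = K * j' + r') :
    j = j' ∧ r = r' := by
  have hK : 0 < K := by omega
  have h1 := congrArg (· / K) h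
  have h2 := congrArg (· % K) h
  simp only [Nat.mul_add_div hK, Nat.mul_add_mod, Nat.div_eq_of_lt hr, Nat.div_eq_of_lt hr',
    Nat.mod_eq_of_lt hr, Nat.mod_eq_of_lt hr', add_zero] at h1 h2
  exact ⟨h1, h2⟩

/-- Modulo `2 * m + 1`, the residue 0 belongs to `y`, `1, …, m` to `w`, and `m + 1, …, 2 * m` to
`z`; the quotient is the layer. -/
lemma code_injective : Function.Injective (code e) := by
  have hy : ∀ i, code e (y i) = (2 * m + 1) * (2 * i) + 0 := fun i => rfl
  rintro (i | ⟨j, u⟩ | ⟨j, u⟩) (k | ⟨k, u'⟩ | ⟨k, u'⟩) h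
  all_goals
    try rw [hy] at h
    try rw [hy] at h
    try simp only [code] at h
    obtain ⟨h1, h2⟩ := mul_add_inj (by omega) (by omega) h
  · congr 1
    omega
  · omega
  · omega
  · omega
  · rw [h1, e.injective (Fin.ext (by omega : (e u : ℕ) = e u'))]
  · omega
  · omega
  · omega
  · rw [h1, e.injective (Fin.ext (by omega : (e u : ℕ) = e u'))]

/-- Move a vertex of the gadget graph by `i` vertices of the given graph. -/
def shift (i : ℕ) : GadgetVertex V → GadgetVertex V
  | y k => y (i + k)
  | w j u => w (2 * i + j) u
  | z j u => z (2 * i + j) u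

/-- One vertex `y i` accounts for two layers of `2 * m + 1` numbers each, so `2 * (2 * m + 1)` is
the multiplier of the machine. -/
lemma code_shift (i : ℕ) (a : GadgetVertex V) :
    code e (shift i a) = 2 * (2 * m + 1) * i + code e a := by
  cases a <;> simp only [shift, code] <;> ring

variable (T : Digraph V) (v : V) (out : Bool)

variable {T v out} in
lemma link_iff_exists_shift {i : ℕ} {a b : GadgetVertex V} : Link T v out i a b ↔
    ∃ a' b', Link T v out 0 a' b' ∧ a = shift i a' ∧ b = shift i b' := by
  constructor
  · intro h
    rcases a with (k | ⟨j, u⟩ | ⟨j, u⟩) <;> rcases b with (l | ⟨l, u'⟩ | ⟨l, u'⟩) <;>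
      simp only [Link] at h
    · refine ⟨y 0, z 0 u', ?_, ?_, ?_⟩ <;> simp only [Link, shift] <;> grind
    · obtain ⟨h1, h⟩ := h
      refine ⟨w (j - 2 * i) u, z (l - 2 * i) u', ?_, ?_, ?_⟩ <;> simp only [Link, shift] <;> grind
    · refine ⟨z 0 u, y 0, ?_, ?_, ?_⟩ <;> simp only [Link, shift] <;> grind
    · refine ⟨z (j - 2 * i) u, w (l - 2 * i) u', ?_, ?_, ?_⟩ <;> simp only [Link, shift] <;> grind
  · rintro ⟨a, b, h, rfl, rfl⟩
    rcases a with (k | ⟨j, u⟩ | ⟨j, u⟩) <;> rcases b with (l | ⟨l, u'⟩ | ⟨l, u'⟩) <;>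
      simp only [Link, shift] at h ⊢ <;> grind

/-- The links for `i` reach up to layer `2 * i + 2`, through the `w`-neighbours of `z (2 * i + 1)
u`. -/
lemma code_lt_of_link {i : ℕ} {a b : GadgetVertex V} (h : Link T v out i a b) :
    code e a < (2 * m + 1) * (2 * i + 3) ∧ code e b < (2 * m + 1) * (2 * i + 3) := by
  have key : ∀ j r, r < 2 * m + 1 → j < 2 * i + 3 →
      (2 * m + 1) * j + r < (2 * m + 1) * (2 * i + 3) := fun j r hr hj =>
    calc (2 * m + 1) * j + r < (2 * m + 1) * (j + 1) := by rw [Nat.mul_succ]; omega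
      _ ≤ _ := Nat.mul_le_mul_left _ hj
  rcases a with (k | ⟨j, u⟩ | ⟨j, u⟩) <;> rcases b with (l | ⟨l, u'⟩ | ⟨l, u'⟩) <;>
    simp only [Link] at h <;> constructor <;>
    first
    | exact key _ _ (by omega) (by omega)
    | exact key _ 0 (by omega) (by omega)

lemma code_lt_of_base {a b : GadgetVertex V} (h : Base T a b) :
    code e a < 2 * m + 1 ∧ code e b < 2 * m + 1 := by
  rcases a with (k | ⟨j, u⟩ | ⟨j, u⟩) <;> rcases b with (l | ⟨l, u'⟩ | ⟨l, u'⟩) <;>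
    simp only [Base] at h
  simp only [code, h.1, h.2.1]
  omega

/-- The arcs of a relation on the vertices of the gadget graph, as pairs of numbers. -/
def codeArcs (R : GadgetVertex V → GadgetVertex V → Prop) : Set (ℕ × ℕ) :=
  {p | ∃ a b, R a b ∧ p = (code e a, code e b)}

lemma finite_codeArcs {R : GadgetVertex V → GadgetVertex V → Prop} {N : ℕ}
    (h : ∀ a b, R a b → code e a < N ∧ code e b < N) : (codeArcs e R).Finite := by
  refine ((Set.finite_Iio N).prod (Set.finite_Iio N)).subset ?_
  rintro _ ⟨a, b, hab, rfl⟩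
  exact h a b hab

/-- The list of the arcs that are added for the vertex with number zero. -/
noncomputable def linkArcs : List (ℕ × ℕ) :=
  (finite_codeArcs e fun _ _ => code_lt_of_link e T v out (i := 0)).toFinset.toList

/-- The list of the arcs of the copy of the target. -/
noncomputable def baseArcs : List (ℕ × ℕ) :=
  (finite_codeArcs e fun _ _ => code_lt_of_base e T).toFinset.toList

/-- The list of all arcs of the gadget graph. -/
noncomputable def arcs (G : Instance) : List (ℕ × ℕ) :=
  G.arcs.map (fun a => (2 * (2 * m + 1) * a.1, 2 * (2 * m + 1) * a.2)) ++
    ((List.range G.order).reverse.flatMap fun i => (linkArcs e T v out).map fun a =>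
      (2 * (2 * m + 1) * i + a.1, 2 * (2 * m + 1) * i + a.2)) ++
    baseArcs e T

variable {T v out}

lemma mem_origArcs {G : Instance} {p : ℕ × ℕ} :
    p ∈ G.arcs.map (fun a => (2 * (2 * m + 1) * a.1, 2 * (2 * m + 1) * a.2)) ↔
      p ∈ codeArcs e (Orig V G) := by
  simp only [List.mem_map, codeArcs, Set.mem_ofPred_eq]
  constructor
  · rintro ⟨⟨i, k⟩, h, rfl⟩
    refine ⟨y i, y k, h, ?_⟩
    simp only [code, Prod.mk.injEq]
    constructor <;> ring
  · rintro ⟨(i | ⟨j, u⟩ | ⟨j, u⟩), (k | ⟨k, u'⟩ | ⟨k, u'⟩), h, rfl⟩ <;> simp only [Orig] at h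
    refine ⟨(i, k), h, ?_⟩
    simp only [code, Prod.mk.injEq]
    constructor <;> ring

lemma mem_linkArcs {i : ℕ} {p : ℕ × ℕ} :
    p ∈ (linkArcs e T v out).map (fun a =>
      (2 * (2 * m + 1) * i + a.1, 2 * (2 * m + 1) * i + a.2)) ↔
        p ∈ codeArcs e (Link T v out i) := by
  simp only [List.mem_map, linkArcs, Finset.mem_toList, Set.Finite.mem_toFinset]
  constructor
  · rintro ⟨_, ⟨a, b, h, rfl⟩, rfl⟩
    exact ⟨shift i a, shift i b, link_iff_exists_shift.2 ⟨a, b, h, rfl, rfl⟩, by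
      simp only [code_shift]⟩
  · rintro ⟨a, b, h, rfl⟩
    obtain ⟨a, b, h', rfl, rfl⟩ := link_iff_exists_shift.1 h
    exact ⟨_, ⟨a, b, h', rfl⟩, by simp only [code_shift]⟩

lemma mem_baseArcs {p : ℕ × ℕ} : p ∈ baseArcs e T ↔ p ∈ codeArcs e (Base T) := by
  simp only [baseArcs, Finset.mem_toList, Set.Finite.mem_toFinset]

lemma mem_arcs {G : Instance} {p : ℕ × ℕ} :
    p ∈ arcs e T v out G ↔ p ∈ codeArcs e (graph T v out G).Adj := by
  simp only [arcs, List.mem_append, List.mem_flatMap, mem_origArcs e, mem_linkArcs, mem_baseArcs,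
    List.mem_reverse, List.mem_range, codeArcs, graph, Set.mem_ofPred_eq]
  constructor
  · rintro ((⟨a, b, h, rfl⟩ | ⟨i, hi, a, b, h, rfl⟩) | ⟨a, b, h, rfl⟩)
    · exact ⟨a, b, .inl h, rfl⟩
    · exact ⟨a, b, .inr (.inl ⟨i, hi, h⟩), rfl⟩
    · exact ⟨a, b, .inr (.inr h), rfl⟩
  · rintro ⟨a, b, h | ⟨i, hi, h⟩ | h, rfl⟩
    · exact .inl (.inl ⟨a, b, h, rfl⟩)
    · exact .inl (.inr ⟨i, hi, a, b, h, rfl⟩)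
    · exact .inr ⟨a, b, h, rfl⟩

lemma code_mem_codeArcs {R : GadgetVertex V → GadgetVertex V → Prop} {a b : GadgetVertex V} :
    (code e a, code e b) ∈ codeArcs e R ↔ R a b := by
  constructor
  · rintro ⟨a', b', h, h'⟩
    rw [Prod.mk.injEq] at h'
    rwa [code_injective e h'.1, code_injective e h'.2]
  · exact fun h => ⟨a, b, h, rfl⟩

lemma disjoint_codeArcs {R S : GadgetVertex V → GadgetVertex V → Prop}
    (h : ∀ a b, R a b → ¬ S a b) {p : ℕ × ℕ} (hR : p ∈ codeArcs e R) : p ∉ codeArcs e S := by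
  obtain ⟨a, b, hab, rfl⟩ := hR
  rw [code_mem_codeArcs]
  exact h a b hab

lemma nodup_arcs (G : Instance) : (arcs e T v out G).Nodup := by
  have hM : 0 < 2 * (2 * m + 1) := by omega
  refine List.Nodup.append (List.Nodup.append ?_ ?_ ?_) (Finset.nodup_toList _) ?_
  · refine G.nodup.map ?_
    rintro ⟨a, b⟩ ⟨c, d⟩ h
    simpa using h
  · refine List.nodup_flatMap.2 ⟨fun i _ => (Finset.nodup_toList _).map ?_, ?_⟩
    · rintro ⟨a, b⟩ ⟨c, d⟩ h
      simpa using h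
    · refine List.Pairwise.imp ?_ (List.nodup_reverse.2 List.nodup_range)
      intro i k hik p hp hp'
      rw [mem_linkArcs] at hp hp'
      refine disjoint_codeArcs e ?_ hp hp'
      -- Either end `z k u` of a link determines its index as `k / 2`.
      rintro (i | ⟨j, u⟩ | ⟨j, u⟩) (k | ⟨k, u'⟩ | ⟨k, u'⟩) h h' <;> simp only [Link] at h h' <;>
        omega
  · intro p hp hp'
    simp only [mem_origArcs e, List.mem_flatMap, mem_linkArcs] at hp hp'
    obtain ⟨i, -, hp'⟩ := hp'
    refine disjoint_codeArcs e ?_ hp hp'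
    rintro (i | ⟨j, u⟩ | ⟨j, u⟩) (k | ⟨k, u'⟩ | ⟨k, u'⟩) h h' <;> simp only [Link, Orig] at h h'
  · intro p hp hp'
    simp only [List.mem_append, mem_origArcs e, List.mem_flatMap, mem_linkArcs, mem_baseArcs] at hp hp'
    rcases hp with hp | ⟨i, -, hp⟩
    · refine disjoint_codeArcs e ?_ hp hp'
      rintro (i | ⟨j, u⟩ | ⟨j, u⟩) (k | ⟨k, u'⟩ | ⟨k, u'⟩) h h' <;> simp only [Base, Orig] at h h'
    · refine disjoint_codeArcs e ?_ hp hp'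
      rintro (i | ⟨j, u⟩ | ⟨j, u⟩) (k | ⟨k, u'⟩ | ⟨k, u'⟩) h h' <;> simp only [Base, Link] at h h'

/-- The extra summand `2 * (2 * m + 1)` makes room for the closing layer `w (2 * G.order) u`, and
for layer 0 when `G` is empty. -/
lemma arcs_lt {G : Instance} {p : ℕ × ℕ} (hp : p ∈ arcs e T v out G) :
    p.1 < 2 * (2 * m + 1) * G.order + 2 * (2 * m + 1) ∧
      p.2 < 2 * (2 * m + 1) * G.order + 2 * (2 * m + 1) := by
  obtain ⟨a, b, h | ⟨i, hi, h⟩ | h, rfl⟩ := (mem_arcs e).1 hp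
  · rcases a with (i | ⟨j, u⟩ | ⟨j, u⟩) <;> rcases b with (k | ⟨k, u'⟩ | ⟨k, u'⟩) <;>
      simp only [Orig] at h
    obtain ⟨hi, hk⟩ := G.arcs_lt _ h
    simp only [code] at hi hk ⊢
    constructor <;> nlinarith
  · have h1 := code_lt_of_link e T v out h
    have h2 : (2 * m + 1) * (2 * i + 3) ≤ 2 * (2 * m + 1) * G.order + 2 * (2 * m + 1) := by
      calc (2 * m + 1) * (2 * i + 3) ≤ (2 * m + 1) * (2 * G.order + 2) :=
            Nat.mul_le_mul_left _ (by omega)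
        _ = _ := by ring
    exact ⟨h1.1.trans_le h2, h1.2.trans_le h2⟩
  · have h1 := code_lt_of_base e T h
    dsimp only
    omega

variable (v out) in
/-- The gadget graph as an instance. -/
noncomputable def toInstance (hT : IsOriented T) (G : Instance) : Instance where
  order := 2 * (2 * m + 1) * G.order + 2 * (2 * m + 1)
  arcs := arcs e T v out G
  arcs_lt _ := arcs_lt e
  nodup := nodup_arcs e G
  oriented i k hik h h' := by
    rw [mem_arcs] at h h'
    obtain ⟨a, b, hab, hp⟩ := h
    obtain ⟨rfl, rfl⟩ := Prod.mk.inj hp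
    rw [code_mem_codeArcs] at h'
    exact graph_isOriented hT a b (fun h => hik (by rw [h])) hab h'

variable {hT : IsOriented T} {G : Instance}

lemma isIrreflexive_toInstance (hG : IsIrreflexive G.graph) :
    IsIrreflexive (toInstance e v out hT G).graph := by
  intro i hi
  obtain ⟨a, b, hab, hp⟩ := (mem_arcs e).1 hi
  obtain ⟨ha, hb⟩ := Prod.mk.inj hp
  obtain rfl := code_injective e (ha.symm.trans hb)
  obtain ⟨k, hk⟩ := loop_of_graph_adj_self hab
  exact hG ⟨k, (G.arcs_lt _ hk).1⟩ hk

/-- The two graphs agree up to isolated vertices: numbers that code no vertex, and gadget vertices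
whose code is too large. Such vertices may take the arbitrary value `v`. -/
lemma exists_isIotInjectiveHom_toInstance_iff :
    (∃ f : Fin (toInstance e v out hT G).order → V,
      IsIotInjectiveHom (toInstance e v out hT G).graph T f) ↔
      ∃ φ, IsIotInjectiveHom (graph T v out G) T φ := by
  set H := toInstance e v out hT G with hH
  have hadj : ∀ a b, (graph T v out G).Adj a b ↔ (code e a, code e b) ∈ H.arcs := fun a b =>
    (code_mem_codeArcs e).symm.trans (mem_arcs e).symm
  have hmem : ∀ i k, (i, k) ∈ H.arcs → ∃ a b, (graph T v out G).Adj a b ∧ i = code e a ∧ k = code e b := by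
    intro i k h
    obtain ⟨a, b, hab, hp⟩ := (mem_arcs e).1 h
    exact ⟨a, b, hab, Prod.mk.inj hp⟩
  constructor
  · rintro ⟨f, hf⟩
    let φ : GadgetVertex V → V := fun a => if h : code e a < H.order then f ⟨code e a, h⟩ else v
    have hφ : ∀ a (h : code e a < H.order), φ a = f ⟨code e a, h⟩ := fun a h => dif_pos h
    refine ⟨φ, fun a b h => ?_, fun x a ha b hb hab => ?_⟩
    · rw [hadj] at h
      have hlt := H.arcs_lt _ h
      rw [hφ a hlt.1, hφ b hlt.2]
      exact hf.map_adj _ _ h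
    · have hlt : ∀ c, c ∈ outNbhd (graph T v out G) x ∪ inNbhd (graph T v out G) x →
          code e x < H.order ∧ code e c < H.order := by
        rintro c (h | h)
        · exact H.arcs_lt _ ((hadj _ _).1 h)
        · exact (H.arcs_lt _ ((hadj _ _).1 h)).symm
      rw [hφ a (hlt a ha).2, hφ b (hlt b hb).2] at hab
      have := hf.injOn ⟨code e x, (hlt a ha).1⟩ (ha.imp (hadj _ _).1 (hadj _ _).1)
        (hb.imp (hadj _ _).1 (hadj _ _).1) hab
      exact code_injective e (congrArg Fin.val this)
  · rintro ⟨φ, hφ⟩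
    let f : Fin H.order → V := fun i => Function.extend (code e) φ (fun _ => v) (i : ℕ)
    have hf : ∀ (i : Fin H.order) a, (i : ℕ) = code e a → f i = φ a := by
      intro i a h
      simp only [f, h]
      exact (code_injective e).extend_apply _ _ _
    refine ⟨f, fun i k h => ?_, fun x i hi k hk hik => ?_⟩
    · obtain ⟨a, b, hab, ha, hb⟩ := hmem _ _ h
      rw [hf i a ha, hf k b hb]
      exact hφ.map_adj _ _ hab
    · have key : ∀ i, i ∈ outNbhd H.graph x ∪ inNbhd H.graph x → ∃ c a, (x : ℕ) = code e c ∧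
          (i : ℕ) = code e a ∧ ((graph T v out G).Adj c a ∨ (graph T v out G).Adj a c) := by
        rintro i (h | h)
        · obtain ⟨a, b, hab, ha, hb⟩ := hmem _ _ h
          exact ⟨a, b, ha, hb, .inl hab⟩
        · obtain ⟨a, b, hab, ha, hb⟩ := hmem _ _ h
          exact ⟨b, a, hb, ha, .inr hab⟩
      obtain ⟨c, a, hc, ha, hca⟩ := key i hi
      obtain ⟨c', b, hc', hb, hcb⟩ := key k hk
      obtain rfl := code_injective e (hc.symm.trans hc')
      rw [hf i a ha, hf k b hb] at hik
      have := hφ.injOn c hca hcb hik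
      exact Fin.ext (by rw [ha, hb, this])

end Gadget

/-! ### Assembling the transformation -/

open Gadget in
/-- The problem for the strict out- or in-neighbourhood of a vertex transforms polynomially to the
problem for the whole reflexive tournament, if that has at least four vertices. -/
theorem exists_isPolynomialTransformation {V : Type*} [Finite V] {T : Digraph V}
    (hT : IsReflexiveTournament T) (v : V) (out : Bool) (hV : 4 ≤ Nat.card V) :
    ∃ f : Instance → Instance,
      IsPolynomialTransformation (IotInjectiveHomTo (induced T (nbhd T v out)))
        (IotInjectiveHomTo T) f ∧
      ∀ G, IsIrreflexive G.graph → IsIrreflexive (f G).graph := by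
  let e := Finite.equivFin V
  refine ⟨toInstance e v out hT.oriented, ⟨?_, fun G => ?_⟩, fun G => isIrreflexive_toInstance e⟩
  -- Both `M` and `c` are `2 * (2 * m + 1)`, read off from the definition of the order.
  · exact nonempty_tm2ComputableInPolyTime _ _ _ (linkArcs e T v out) (baseArcs e T)
      (fun _ => rfl) (fun _ => rfl)
  · exact ((exists_isIotInjectiveHom_toInstance_iff e).trans
      (exists_isIotInjectiveHom_iff hT hV)).symm

end IotHom

/-- Instances are oriented graphs in the sense that any two distinct vertices are joined by at
most one arc. The transformation moreover keeps instances free of loops, so that it also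
transforms the problems restricted to irreflexive instances. -/
theorem mainTheorem8 {V : Type*} [Finite V] (T : Digraph V)
    (hT : IotHom.IsReflexiveTournament T) (v : V) :
    (4 ≤ IotHom.outDegree T v →
      ∃ f : IotHom.Instance → IotHom.Instance,
        IotHom.IsPolynomialTransformation
          (IotHom.IotInjectiveHomTo (IotHom.induced T (IotHom.strictOutNbhd T v)))
          (IotHom.IotInjectiveHomTo T) f ∧
        ∀ G, IotHom.IsIrreflexive G.graph → IotHom.IsIrreflexive (f G).graph) ∧
    (4 ≤ IotHom.inDegree T v →
      ∃ f : IotHom.Instance → IotHom.Instance,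
        IotHom.IsPolynomialTransformation
          (IotHom.IotInjectiveHomTo (IotHom.induced T (IotHom.strictInNbhd T v)))
          (IotHom.IotInjectiveHomTo T) f ∧
        ∀ G, IotHom.IsIrreflexive G.graph → IotHom.IsIrreflexive (f G).graph) := by
  refine ⟨fun h => ?_, fun h => ?_⟩
  -- `nbhd` unfolds to the strict neighbourhood once the Boolean is fixed.
  · exact IotHom.exists_isPolynomialTransformation hT v true (h.trans (Set.ncard_le_card _))
  · exact IotHom.exists_isPolynomialTransformation hT v false (h.trans (Set.ncard_le_card _))
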